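/- Fix an integer $n\ge 1$, a set $\Pi_0$ of atomic programs and a set $\mathsf{Prop}$ of propositional variables. Formulas and programs are given by $$\phi::=p\mid 0\mid\neg\phi\mid\phi\to\phi\mid[\alpha]\phi,\qquad \alpha::=a\mid\phi?\mid\alpha;\alpha\mid\alpha\cup\alpha\mid\alpha^*\qquad(p\in\mathsf{Prop},\ a\in\Pi_0).$$ Abbreviate $1=\neg 0$, $\phi\vee\psi=(\phi\to\psi)\to\psi$, $\phi\wedge\psi=\neg(\neg\phi\vee\neg\psi)$, $\phi\oplus\psi=\neg\phi\to\psi$, $\phi\odot\psi=\neg(\neg\phi\oplus\neg\psi)$, $\phi\leftrightarrow\psi=(\phi\to\psi)\odot(\psi\to\phi)$, $\phi^k=\phi\odot\cdots\odot\phi$ ($k$ factors; $\phi^0=1$). Let $Ł_n=\{i/n\mid 0\le i\le n\}$, with the operations $x\to y=\min(1-x+y,1)$, $\neg x=1-x$ and the constant $1$. Let $\mathrm{PDL}_n$ be the smallest set of formulas that is closed under modus ponens, uniform substitution and necessitation ($\phi/[\alpha]\phi$) and that contains all instances of the tautologies of $n+1$-valued Łukasiewicz logic and, for all programs $\alpha,\beta$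 and formulas $\phi,\psi$, the formulas $[\alpha](\phi\to\psi)\to([\alpha]\phi\to[\alpha]\psi)$; $[\alpha](\phi\oplus\phi)\leftrightarrow([\alpha]\phi\oplus[\alpha]\phi)$; $[\alpha](\phi\odot\phi)\leftrightarrow([\alpha]\phi\odot[\alpha]\phi)$; $[\alpha\cup\beta]\phi\leftrightarrow([\alpha]\phi\wedge[\beta]\phi)$; $[\alpha;\beta]\phi\leftrightarrow[\alpha][\beta]\phi$; $[\psi?]\phi\leftrightarrow(\neg(\psi^n)\vee\phi)$; $[\alpha^*]\phi\leftrightarrow(\phi\wedge[\alpha][\alpha^*]\phi)$; $[\alpha^*]\phi\to[\alpha^*][\alpha^*]\phi$; $(\phi\wedge[\alpha^*]((\phi\to[\alpha]\phi)^n))\to[\alpha^*]\phi$. Let $\mathcal F_n$ be the Lindenbaum–Tarski algebra of $\mathrm{PDL}_n$, i.e. the quotient of the set of formulas by $\phi\equiv\psi\iff(\phi\leftrightarrow\psi)\in\mathrm{PDL}_n$, with the induced operations $\to$, $\neg$, $1$ and $[\alpha]$. The canonical model $\langle W,R,\mathrm{Val}\rangle$ of $\mathrm{PDL}_n$ has as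 set of worlds $W$ the set of all MV-algebra homomorphisms $u:\mathcal F_n\to Ł_n$ (maps preserving $\to,\neg,1$); for each program $\alpha$, $(u,v)\in R_\alpha$ if and only if for all $x\in\mathcal F_n$, $u([\alpha]x)=1$ implies $v(x)=1$; and $\mathrm{Val}(u,\phi)=u(\phi/{\equiv})$ for each formula $\phi$. **Theorem.** The canonical model of $\mathrm{PDL}_n$ is an $n+1$-valued non-standard Kripke model. That is, $W$ is nonempty; for all $u\in W$, all formulas $\phi,\psi$ and all programs $\alpha,\beta$, $\mathrm{Val}(u,0)=0$, $\mathrm{Val}(u,\neg\phi)=1-\mathrm{Val}(u,\phi)$, $\mathrm{Val}(u,\phi\to\psi)=\min(1-\mathrm{Val}(u,\phi)+\mathrm{Val}(u,\psi),1)$, $\mathrm{Val}(u,[\alpha]\phi)=\bigwedge\{\mathrm{Val}(v,\phi)\mid(u,v)\in R_\alpha\}$ (meet in $Ł_n$, so that the empty meet is $1$); and moreover (1) $R_{\alpha;\beta}=R_\alpha\circ R_\beta=\{(u,w)\mid\exists v\,((u,v)\in R_\alpha,\ (v,w)\in R_\beta)\}$, $R_{\alpha\cup\beta}=R_\alpha\cup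 R_\beta$, and $R_{\psi?}=\{(u,u)\mid\mathrm{Val}(u,\psi)=1\}$; (2) $R_{\alpha^*}$ is reflexive, transitive and contains $R_\alpha$; (3) the formulas $[\alpha^*]\phi\to(\phi\wedge[\alpha][\alpha^*]\phi)$, $[\alpha^*]\phi\to[\alpha^*][\alpha^*]\phi$ and $(\phi\wedge[\alpha^*]((\phi\to[\alpha]\phi)^n))\to[\alpha^*]\phi$ have the value $1$ in every world. In (3), even the formula $[\alpha^*]\phi\leftrightarrow(\phi\wedge[\alpha][\alpha^*]\phi)$ has the value $1$ in every world. -/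

import Mathlib

universe u v w

namespace PDLn

/- Syntax.  `A` is the set of atomic programs and `V` the set of propositional variables. -/

mutual
/-- Well formed formulas: `φ ::= p ∣ 0 ∣ ¬φ ∣ φ → φ ∣ [α]φ`. -/
inductive Form (A : Type u) (V : Type v) : Type (max u v) where
  | var : V → Form A V
  | bot : Form A V
  | neg : Form A V → Form A V
  | imp : Form A V → Form A V → Form A V
  | box : Prog A V → Form A V → Form A V
/-- Programs: `α ::= a ∣ φ? ∣ α;α ∣ α ∪ α ∣ α*`. -/
inductive Prog (A : Type u) (V : Type v) : Type (max u v) where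
  | atom : A → Prog A V
  | test : Form A V → Prog A V
  | seq : Prog A V → Prog A V → Prog A V
  | union : Prog A V → Prog A V → Prog A V
  | star : Prog A V → Prog A V
end

mutual
/-- Uniform substitution of formulas for propositional variables (also inside tests). -/
def Form.subst {A : Type u} {V : Type v} (σ : V → Form A V) : Form A V → Form A V
  | .var p => σ p
  | .bot => .bot
  | .neg φ => .neg (φ.subst σ)
  | .imp φ ψ => .imp (φ.subst σ) (ψ.subst σ)
  | .box α φ => .box (α.subst σ) (φ.subst σ)
/-- Uniform substitution in programs. -/
def Prog.subst {A : Type u} {V : Type v} (σ : V → Form A V) : Prog A V → Prog A V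
  | .atom a => .atom a
  | .test φ => .test (φ.subst σ)
  | .seq α β => .seq (α.subst σ) (β.subst σ)
  | .union α β => .union (α.subst σ) (β.subst σ)
  | .star α => .star (α.subst σ)
end

namespace Form

variable {A : Type u} {V : Type v}

/-- The constant `1`. -/
def top : Form A V := .neg .bot

/-- `φ ∨ ψ` is `(φ → ψ) → ψ`. -/
def or (φ ψ : Form A V) : Form A V := .imp (.imp φ ψ) ψ

/-- `φ ∧ ψ` is `¬(¬φ ∨ ¬ψ)`. -/
def and (φ ψ : Form A V) : Form A V := .neg (or (.neg φ) (.neg ψ))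

/-- Strong disjunction: `φ ⊕ ψ` is `¬φ → ψ`. -/
def oplus (φ ψ : Form A V) : Form A V := .imp (.neg φ) ψ

/-- Strong conjunction: `φ ⊙ ψ` is `¬(¬φ ⊕ ¬ψ)`. -/
def odot (φ ψ : Form A V) : Form A V := .neg (oplus (.neg φ) (.neg ψ))

/-- `φ ↔ ψ` is `(φ → ψ) ⊙ (ψ → φ)`. -/
def iff (φ ψ : Form A V) : Form A V := odot (.imp φ ψ) (.imp ψ φ)

/-- `φ ^ k` is `φ ⊙ ⋯ ⊙ φ` with `k` factors, and `φ ^ 0` is `1`. -/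
def pow (φ : Form A V) : ℕ → Form A V
  | 0 => top
  | 1 => φ
  | k + 2 => odot (pow φ (k + 1)) φ

end Form

/- MV-algebras. -/

/-- MV-algebras, as algebras `⟨M, →, ¬, 1⟩` of type `(2,1,0)`. -/
class MVAlgebra (M : Type w) where
  imp : M → M → M
  neg : M → M
  one : M
  one_imp : ∀ x : M, imp one x = x
  imp_trans : ∀ x y z : M, imp (imp x y) (imp (imp y z) (imp x z)) = one
  imp_comm : ∀ x y : M, imp (imp x y) y = imp (imp y x) x
  neg_imp_neg : ∀ x y : M, imp (imp (neg x) (neg y)) (imp y x) = one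

/-- Homomorphisms of MV-algebras. -/
structure MVHom (M : Type u) (N : Type v) [MVAlgebra M] [MVAlgebra N] where
  toFun : M → N
  map_imp : ∀ x y : M, toFun (MVAlgebra.imp x y) = MVAlgebra.imp (toFun x) (toFun y)
  map_neg : ∀ x : M, toFun (MVAlgebra.neg x) = MVAlgebra.neg (toFun x)
  map_one : toFun MVAlgebra.one = MVAlgebra.one

/-- The set `Ł_n = {i / n ∣ 0 ≤ i ≤ n}` of truth values. -/
def Luk (n : ℕ) : Set ℝ := {x | ∃ i : ℕ, i ≤ n ∧ x = (i : ℝ) / (n : ℝ)}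

theorem Luk.bounds {n : ℕ} (x : Luk n) : 0 ≤ (x : ℝ) ∧ (x : ℝ) ≤ 1 := by
  obtain ⟨x, i, hi, rfl⟩ := x
  exact ⟨by positivity, div_le_one_of_le₀ (by exact_mod_cast hi) (by positivity)⟩

theorem Luk.one_mem {n : ℕ} [NeZero n] : (1 : ℝ) ∈ Luk n :=
  ⟨n, le_rfl, (div_self (by exact_mod_cast NeZero.ne n)).symm⟩

theorem Luk.neg_mem {n : ℕ} [NeZero n] (x : Luk n) : 1 - (x : ℝ) ∈ Luk n := by
  have hn : (n : ℝ) ≠ 0 := by exact_mod_cast NeZero.ne n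
  obtain ⟨x, i, hi, rfl⟩ := x
  refine ⟨n - i, Nat.sub_le _ _, ?_⟩
  push_cast [Nat.cast_sub hi]
  field_simp

theorem Luk.imp_mem {n : ℕ} [NeZero n] (x y : Luk n) :
    min (1 - (x : ℝ) + (y : ℝ)) 1 ∈ Luk n := by
  have hn : (n : ℝ) ≠ 0 := by exact_mod_cast NeZero.ne n
  have hn0 : (0 : ℝ) < n := by positivity
  obtain ⟨x, i, hi, rfl⟩ := x
  obtain ⟨y, j, hj, rfl⟩ := y
  rcases le_total i j with h | h
  · have h1 : (i : ℝ) / n ≤ (j : ℝ) / n := by gcongr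
    rw [min_eq_right (by simpa using by linarith)]
    exact Luk.one_mem
  · have h1 : (j : ℝ) / n ≤ (i : ℝ) / n := by gcongr
    rw [min_eq_left (by simpa using by linarith)]
    refine ⟨n - i + j, by omega, ?_⟩
    push_cast [Nat.cast_sub hi]
    field_simp

/-- `Ł_n` with the Łukasiewicz operations `x → y = min (1 - x + y) 1` and `¬x = 1 - x`. -/
noncomputable instance Luk.instMVAlgebra (n : ℕ) [NeZero n] : MVAlgebra (Luk n) where
  imp x y := ⟨min (1 - (x : ℝ) + (y : ℝ)) 1, Luk.imp_mem x y⟩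
  neg x := ⟨1 - (x : ℝ), Luk.neg_mem x⟩
  one := ⟨1, Luk.one_mem⟩
  one_imp x := by
    have := Luk.bounds x
    apply Subtype.ext
    simp [this.2]
  imp_trans x y z := by
    have hx := Luk.bounds x
    have hy := Luk.bounds y
    have hz := Luk.bounds z
    apply Subtype.ext
    simp only [min_def]
    split_ifs <;> linarith
  imp_comm x y := by
    have hx := Luk.bounds x
    have hy := Luk.bounds y
    apply Subtype.ext
    simp only [min_def]
    split_ifs <;> linarith
  neg_imp_neg x y := by
    have hx := Luk.bounds x
    have hy := Luk.bounds y
    apply Subtype.ext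
    simp only [min_def]
    split_ifs <;> linarith

/- The deductive system. -/

section System

variable {A : Type u} {V : Type v}

/-- `φ` is (a substitution instance of) a tautology of the `n+1`-valued Łukasiewicz logic: it takes
the value `1` under all assignments of values in `Ł_n` to the formulas that respect `0`, `¬` and
`→`, variables and formulas `[α]ψ` being assigned arbitrary values. -/
def IsLukTautology (n : ℕ) (φ : Form A V) : Prop :=
  ∀ e : Form A V → Luk n,
    (e .bot : ℝ) = 0 →
    (∀ ψ, (e (.neg ψ) : ℝ) = 1 - (e ψ : ℝ)) →
    (∀ ψ χ, (e (.imp ψ χ) : ℝ) = min (1 - (e ψ : ℝ) + (e χ : ℝ)) 1) →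
    (e φ : ℝ) = 1

/-- `n+1`-valued propositional dynamic logics.  Since they are closed under uniform substitution,
the axioms are given as schemes. -/
structure IsLogic (n : ℕ) (L : Set (Form A V)) : Prop where
  modus_ponens : ∀ φ ψ : Form A V, φ ∈ L → .imp φ ψ ∈ L → ψ ∈ L
  substitution : ∀ (σ : V → Form A V) (φ : Form A V), φ ∈ L → φ.subst σ ∈ L
  necessitation : ∀ (α : Prog A V) (φ : Form A V), φ ∈ L → .box α φ ∈ L
  tautology : ∀ φ : Form A V, IsLukTautology n φ → φ ∈ L
  box_imp : ∀ (α : Prog A V) (φ ψ : Form A V),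
    .imp (.box α (.imp φ ψ)) (.imp (.box α φ) (.box α ψ)) ∈ L
  box_oplus : ∀ (α : Prog A V) (φ : Form A V),
    Form.iff (.box α (.oplus φ φ)) (.oplus (.box α φ) (.box α φ)) ∈ L
  box_odot : ∀ (α : Prog A V) (φ : Form A V),
    Form.iff (.box α (.odot φ φ)) (.odot (.box α φ) (.box α φ)) ∈ L
  box_union : ∀ (α β : Prog A V) (φ : Form A V),
    Form.iff (.box (.union α β) φ) (.and (.box α φ) (.box β φ)) ∈ L
  box_seq : ∀ (α β : Prog A V) (φ : Form A V),
    Form.iff (.box (.seq α β) φ) (.box α (.box β φ)) ∈ L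
  box_test : ∀ ψ φ : Form A V,
    Form.iff (.box (.test ψ) φ) (.or (.neg (ψ.pow n)) φ) ∈ L
  box_star : ∀ (α : Prog A V) (φ : Form A V),
    Form.iff (.box (.star α) φ) (.and φ (.box α (.box (.star α) φ))) ∈ L
  box_star_star : ∀ (α : Prog A V) (φ : Form A V),
    .imp (.box (.star α) φ) (.box (.star α) (.box (.star α) φ)) ∈ L
  induction : ∀ (α : Prog A V) (φ : Form A V),
    .imp (.and φ (.box (.star α) (Form.pow (.imp φ (.box α φ)) n))) (.box (.star α) φ) ∈ L

/-- `PDL_n`, the smallest `n+1`-valued propositional dynamic logic. -/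
def PDL (n : ℕ) (A : Type u) (V : Type v) : Set (Form A V) := ⋂₀ {L | IsLogic n L}

theorem PDL.isLogic (n : ℕ) (A : Type u) (V : Type v) : IsLogic n (PDL n A V) where
  modus_ponens φ ψ h h' L hL := hL.modus_ponens φ ψ (h L hL) (h' L hL)
  substitution σ φ h L hL := hL.substitution σ φ (h L hL)
  necessitation α φ h L hL := hL.necessitation α φ (h L hL)
  tautology φ h _ hL := hL.tautology φ h
  box_imp α φ ψ _ hL := hL.box_imp α φ ψ
  box_oplus α φ _ hL := hL.box_oplus α φ
  box_odot α φ _ hL := hL.box_odot α φ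
  box_union α β φ _ hL := hL.box_union α β φ
  box_seq α β φ _ hL := hL.box_seq α β φ
  box_test ψ φ _ hL := hL.box_test ψ φ
  box_star α φ _ hL := hL.box_star α φ
  box_star_star α φ _ hL := hL.box_star_star α φ
  induction α φ _ hL := hL.induction α φ

/- Facts on `PDL_n` that are needed to define the Lindenbaum-Tarski algebra. -/

theorem eval_iff {n : ℕ} (e : Form A V → Luk n)
    (hn : ∀ ψ, (e (.neg ψ) : ℝ) = 1 - (e ψ : ℝ))
    (hi : ∀ ψ χ, (e (.imp ψ χ) : ℝ) = min (1 - (e ψ : ℝ) + (e χ : ℝ)) 1) (φ ψ : Form A V) :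
    (e (Form.iff φ ψ) : ℝ) = 1 - |(e φ : ℝ) - e ψ| := by
  have h1 := Luk.bounds (e φ)
  have h2 := Luk.bounds (e ψ)
  simp only [Form.iff, Form.odot, Form.oplus, hn, hi, min_def, abs_eq_max_neg, max_def]
  split_ifs <;> linarith

theorem PDL.iff_of_eval_eq {n : ℕ} {φ ψ : Form A V}
    (h : ∀ e : Form A V → Luk n, (e .bot : ℝ) = 0 →
      (∀ ψ, (e (.neg ψ) : ℝ) = 1 - (e ψ : ℝ)) →
      (∀ ψ χ, (e (.imp ψ χ) : ℝ) = min (1 - (e ψ : ℝ) + (e χ : ℝ)) 1) →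
      (e φ : ℝ) = e ψ) : Form.iff φ ψ ∈ PDL n A V := by
  refine (PDL.isLogic n A V).tautology _ fun e h0 hn hi => ?_
  rw [eval_iff e hn hi, h e h0 hn hi]
  simp

theorem PDL.imp_of_iff {n : ℕ} {φ ψ : Form A V} (h : Form.iff φ ψ ∈ PDL n A V) :
    Form.imp φ ψ ∈ PDL n A V := by
  refine (PDL.isLogic n A V).modus_ponens _ _ h ?_
  refine (PDL.isLogic n A V).tautology _ fun e h0 hn hi => ?_
  have h1 := Luk.bounds (e φ)
  have h2 := Luk.bounds (e ψ)
  simp only [eval_iff e hn hi, hi, min_def, abs_eq_max_neg, max_def]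
  split_ifs <;> linarith

theorem PDL.iff_symm {n : ℕ} {φ ψ : Form A V} (h : Form.iff φ ψ ∈ PDL n A V) :
    Form.iff ψ φ ∈ PDL n A V := by
  refine (PDL.isLogic n A V).modus_ponens _ _ h ?_
  refine (PDL.isLogic n A V).tautology _ fun e h0 hn hi => ?_
  rw [hi, eval_iff e hn hi, eval_iff e hn hi, abs_sub_comm]
  simp

theorem PDL.iff_of_two {n : ℕ} {φ ψ χ : Form A V} (h : φ ∈ PDL n A V) (h' : ψ ∈ PDL n A V)
    (ht : ∀ e : Form A V → Luk n, (e .bot : ℝ) = 0 →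
      (∀ ψ, (e (.neg ψ) : ℝ) = 1 - (e ψ : ℝ)) →
      (∀ ψ χ, (e (.imp ψ χ) : ℝ) = min (1 - (e ψ : ℝ) + (e χ : ℝ)) 1) →
      (e φ : ℝ) + e ψ ≤ 1 + e χ) : χ ∈ PDL n A V := by
  refine (PDL.isLogic n A V).modus_ponens _ _ h'
    ((PDL.isLogic n A V).modus_ponens φ (.imp ψ χ) h ?_)
  refine (PDL.isLogic n A V).tautology _ fun e h0 hn hi => ?_
  have h1 := ht e h0 hn hi
  have h2 := Luk.bounds (e φ)
  simp only [hi, min_def]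
  split_ifs <;> linarith

theorem PDL.iff_of_imp {n : ℕ} {φ ψ : Form A V} (h : Form.imp φ ψ ∈ PDL n A V)
    (h' : Form.imp ψ φ ∈ PDL n A V) : Form.iff φ ψ ∈ PDL n A V := by
  refine PDL.iff_of_two h h' fun e h0 hn hi => ?_
  have h1 := Luk.bounds (e φ)
  have h2 := Luk.bounds (e ψ)
  simp only [eval_iff e hn hi, hi, min_def, abs_eq_max_neg, max_def]
  split_ifs <;> linarith

theorem PDL.iff_trans {n : ℕ} {φ ψ χ : Form A V} (h : Form.iff φ ψ ∈ PDL n A V)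
    (h' : Form.iff ψ χ ∈ PDL n A V) : Form.iff φ χ ∈ PDL n A V := by
  refine PDL.iff_of_two h h' fun e h0 hn hi => ?_
  have := abs_sub_le (e φ : ℝ) (e ψ) (e χ)
  simp only [eval_iff e hn hi]
  linarith

theorem PDL.iff_neg {n : ℕ} {φ ψ : Form A V} (h : Form.iff φ ψ ∈ PDL n A V) :
    Form.iff (.neg φ) (.neg ψ) ∈ PDL n A V := by
  refine (PDL.isLogic n A V).modus_ponens _ _ h ?_
  refine (PDL.isLogic n A V).tautology _ fun e h0 hn hi => ?_
  rw [hi, eval_iff e hn hi, eval_iff e hn hi, hn, hn, abs_sub_comm]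
  simp

theorem PDL.iff_imp {n : ℕ} {φ φ' ψ ψ' : Form A V} (h : Form.iff φ φ' ∈ PDL n A V)
    (h' : Form.iff ψ ψ' ∈ PDL n A V) : Form.iff (.imp φ ψ) (.imp φ' ψ') ∈ PDL n A V := by
  refine PDL.iff_of_two h h' fun e h0 hn hi => ?_
  simp only [eval_iff e hn hi, hi]
  have := abs_min_sub_min_le_max (1 - (e φ : ℝ) + e ψ) 1 (1 - (e φ' : ℝ) + e ψ') 1
  have h2 : |(1 - (e φ : ℝ) + e ψ) - (1 - (e φ' : ℝ) + e ψ')|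
      ≤ |(e φ : ℝ) - e φ'| + |(e ψ : ℝ) - e ψ'| := by
    have h3 := abs_sub ((e ψ : ℝ) - e ψ') ((e φ : ℝ) - e φ')
    have h4 : (1 - (e φ : ℝ) + e ψ) - (1 - (e φ' : ℝ) + e ψ')
      = ((e ψ : ℝ) - e ψ') - ((e φ : ℝ) - e φ') := by ring
    rw [h4]
    linarith
  simp only [sub_self, abs_zero, abs_nonneg, sup_of_le_left] at this
  linarith

theorem PDL.iff_box {n : ℕ} (α : Prog A V) {φ ψ : Form A V} (h : Form.iff φ ψ ∈ PDL n A V) :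
    Form.iff (.box α φ) (.box α ψ) ∈ PDL n A V := by
  have key : ∀ {φ ψ : Form A V}, Form.imp φ ψ ∈ PDL n A V →
      Form.imp (.box α φ) (.box α ψ) ∈ PDL n A V := fun {φ ψ} h =>
    (PDL.isLogic n A V).modus_ponens _ _ ((PDL.isLogic n A V).necessitation α _ h)
      ((PDL.isLogic n A V).box_imp α φ ψ)
  exact PDL.iff_of_imp (key (PDL.imp_of_iff h)) (key (PDL.imp_of_iff (PDL.iff_symm h)))

/-- Syntactic equivalence: `φ ≡ ψ` if `φ ↔ ψ` is a theorem of `PDL_n`. -/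
def synEquiv (n : ℕ) (A : Type u) (V : Type v) : Setoid (Form A V) where
  r φ ψ := Form.iff φ ψ ∈ PDL n A V
  iseqv :=
    ⟨fun _ => PDL.iff_of_eval_eq fun _ _ _ _ => rfl, fun h => PDL.iff_symm h,
      fun h h' => PDL.iff_trans h h'⟩

/-- The Lindenbaum-Tarski algebra of `PDL_n`. -/
def LTAlgebra (n : ℕ) (A : Type u) (V : Type v) : Type (max u v) := Quotient (synEquiv n A V)

/-- The class of a formula. -/
def LTAlgebra.mk (n : ℕ) (φ : Form A V) : LTAlgebra n A V := Quotient.mk (synEquiv n A V) φ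

/-- The operation `[α]` on the Lindenbaum-Tarski algebra. -/
def LTAlgebra.box {n : ℕ} (α : Prog A V) : LTAlgebra n A V → LTAlgebra n A V :=
  Quotient.map (Form.box α) fun _ _ h => PDL.iff_box α h

/-- The MV-algebra reduct of the Lindenbaum-Tarski algebra. -/
instance LTAlgebra.instMVAlgebra (n : ℕ) : MVAlgebra (LTAlgebra n A V) where
  imp := Quotient.map₂ Form.imp fun _ _ h _ _ h' => PDL.iff_imp h h'
  neg := Quotient.map Form.neg fun _ _ h => PDL.iff_neg h
  one := LTAlgebra.mk n Form.top
  one_imp x := by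
    induction x using Quotient.inductionOn with | h φ => ?_
    refine Quotient.sound (PDL.iff_of_eval_eq fun e h0 hn hi => ?_)
    simp [Form.top, h0, hn, hi, (Luk.bounds (e φ)).2]
  imp_trans x y z := by
    induction x using Quotient.inductionOn with | h φ => ?_
    induction y using Quotient.inductionOn with | h ψ => ?_
    induction z using Quotient.inductionOn with | h χ => ?_
    refine Quotient.sound (PDL.iff_of_eval_eq fun e h0 hn hi => ?_)
    have hx := Luk.bounds (e φ)
    have hy := Luk.bounds (e ψ)
    have hz := Luk.bounds (e χ)
    simp only [Form.top, h0, hn, hi, min_def]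
    split_ifs <;> linarith
  imp_comm x y := by
    induction x using Quotient.inductionOn with | h φ => ?_
    induction y using Quotient.inductionOn with | h ψ => ?_
    refine Quotient.sound (PDL.iff_of_eval_eq fun e h0 hn hi => ?_)
    have hx := Luk.bounds (e φ)
    have hy := Luk.bounds (e ψ)
    simp only [hi, min_def]
    split_ifs <;> linarith
  neg_imp_neg x y := by
    induction x using Quotient.inductionOn with | h φ => ?_
    induction y using Quotient.inductionOn with | h ψ => ?_
    refine Quotient.sound (PDL.iff_of_eval_eq fun e h0 hn hi => ?_)
    have hx := Luk.bounds (e φ)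
    have hy := Luk.bounds (e ψ)
    simp only [Form.top, h0, hn, hi, min_def]
    split_ifs <;> linarith

end System

/- Non standard models. -/

/-- The data `⟨W, R, Val⟩`, with a relation for every program and a truth value in `Ł_n` for every
formula in every world; nothing is required of them yet. -/
structure PreModel (n : ℕ) (A : Type u) (V : Type v) where
  World : Type w
  R : Prog A V → World → World → Prop
  Val : World → Form A V → Luk n

/-- `φ` is true in the model: it has the value `1` in each world. -/
def PreModel.Models {n : ℕ} {A : Type u} {V : Type v} (M : PreModel.{u, v, w} n A V)
    (φ : Form A V) : Prop :=
  ∀ x : M.World, (M.Val x φ : ℝ) = 1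

/-- `M` is a weak non standard `n+1`-valued Kripke model: there is a world, and the valuation of
formulas is the extension of the valuation of the propositional variables by the inductive rules.
The value of `[α]φ` is a meet in `Ł_n`, which is `1` when the world has no `α`-successor. -/
structure PreModel.IsWeakNonStandard {n : ℕ} {A : Type u} {V : Type v}
    (M : PreModel.{u, v, w} n A V) : Prop where
  nonempty : Nonempty M.World
  val_bot : ∀ x, (M.Val x .bot : ℝ) = 0
  val_imp : ∀ x φ ψ, (M.Val x (.imp φ ψ) : ℝ) = min (1 - (M.Val x φ : ℝ) + (M.Val x ψ : ℝ)) 1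
  val_neg : ∀ x φ, (M.Val x (.neg φ) : ℝ) = 1 - (M.Val x φ : ℝ)
  val_box : ∀ x α φ, IsGLB {t : Luk n | ∃ y, M.R α x y ∧ M.Val y φ = t} (M.Val x (.box α φ))

/-- `M` is a non standard `n+1`-valued Kripke model. -/
structure PreModel.IsNonStandard {n : ℕ} {A : Type u} {V : Type v}
    (M : PreModel.{u, v, w} n A V) : Prop extends M.IsWeakNonStandard where
  rel_seq : ∀ α β x z, M.R (.seq α β) x z ↔ ∃ y, M.R α x y ∧ M.R β y z
  rel_union : ∀ α β x y, M.R (.union α β) x y ↔ M.R α x y ∨ M.R β x y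
  rel_test : ∀ ψ x y, M.R (.test ψ) x y ↔ x = y ∧ (M.Val x ψ : ℝ) = 1
  star_refl : ∀ α x, M.R (.star α) x x
  star_trans : ∀ α x y z, M.R (.star α) x y → M.R (.star α) y z → M.R (.star α) x z
  star_extends : ∀ α x y, M.R α x y → M.R (.star α) x y
  models_star : ∀ α φ,
    M.Models (.imp (.box (.star α) φ) (.and φ (.box α (.box (.star α) φ))))
  models_star_star : ∀ α φ,
    M.Models (.imp (.box (.star α) φ) (.box (.star α) (.box (.star α) φ)))
  models_induction : ∀ α φ,
    M.Models (.imp (.and φ (.box (.star α) (Form.pow (.imp φ (.box α φ)) n))) (.box (.star α) φ))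

/-- The canonical model of `PDL_n`: its worlds are the MV-homomorphisms from the Lindenbaum-Tarski
algebra to `Ł_n`. -/
def canonicalModel (n : ℕ) [NeZero n] (A : Type u) (V : Type v) :
    PreModel.{u, v, max u v} n A V where
  World := MVHom (LTAlgebra n A V) (Luk n)
  R α f g := ∀ x : LTAlgebra n A V, (f.toFun (x.box α) : ℝ) = 1 → (g.toFun x : ℝ) = 1
  Val f φ := f.toFun (LTAlgebra.mk n φ)

end PDLn

-- A world amounts to a valuation of formulas in `Luk n` that respects the connectives and gives the
-- theorems of `PDL n A V` the value 1. For a world u and a program α, the formulas φ with u([α]φ) =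
-- 1 form a theory containing `PDL n A V`, and the α-successors of u are the worlds where this
-- theory has the value 1.
--
-- Successors come from `IsTheory.exists_valuation`, a prime filter theorem: a theory is separated
-- from a disjoint directed set of formulas. It rests on Tychonoff's theorem for valuations in the
-- finite discrete space `Luk n`, and on φ^n having only the values 0 and 1, which yields
-- `IsTheory.mem_of_entails`.
--
-- The relations only see the value 1, whereas the rule for [α]φ concerns all values. Threshold
-- formulas bridge the gap: they are built from φ ⊕ φ and φ ⊙ φ, hence commute with [α], and for any
-- a < b one of them is 0 up to a and 1 from b on.
--
-- The conditions on the relations then follow from the axioms; composition and union also use that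
-- a formula φ ∨ ψ has the value 1 only if φ or ψ does. A world exists because a model with one
-- world shows that `PDL n A V` is consistent.

namespace PDLn

section Canonical

variable {A : Type u} {V : Type v} {n : ℕ}

/-- Valuations of formulas in `Ł_n` that respect the propositional connectives. -/
structure IsValuation (e : Form A V → Luk n) : Prop where
  bot : (e .bot : ℝ) = 0
  neg : ∀ φ, (e (.neg φ) : ℝ) = 1 - (e φ : ℝ)
  imp : ∀ φ ψ, (e (.imp φ ψ) : ℝ) = min (1 - (e φ : ℝ) + (e ψ : ℝ)) 1

-- Values of the derived connectives and of powers.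

namespace IsValuation

variable {e : Form A V → Luk n}

theorem top (he : IsValuation e) : (e .top : ℝ) = 1 := by
  simp [Form.top, he.neg, he.bot]

theorem or (he : IsValuation e) (φ ψ : Form A V) :
    (e (.or φ ψ) : ℝ) = max (e φ : ℝ) (e ψ) := by
  have h1 := Luk.bounds (e φ)
  have h2 := Luk.bounds (e ψ)
  simp only [Form.or, he.imp, min_def, max_def]
  split_ifs <;> linarith

theorem and (he : IsValuation e) (φ ψ : Form A V) :
    (e (.and φ ψ) : ℝ) = min (e φ : ℝ) (e ψ) := by
  simp only [Form.and, he.neg, he.or, min_def, max_def]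
  split_ifs <;> linarith

theorem oplus (he : IsValuation e) (φ ψ : Form A V) :
    (e (.oplus φ ψ) : ℝ) = min ((e φ : ℝ) + e ψ) 1 := by
  simp only [Form.oplus, he.neg, he.imp, sub_sub_cancel]

theorem odot (he : IsValuation e) (φ ψ : Form A V) :
    (e (.odot φ ψ) : ℝ) = max ((e φ : ℝ) + e ψ - 1) 0 := by
  simp only [Form.odot, he.neg, he.oplus, min_def, max_def]
  split_ifs <;> linarith

theorem iff (he : IsValuation e) (φ ψ : Form A V) :
    (e (Form.iff φ ψ) : ℝ) = 1 - |(e φ : ℝ) - e ψ| :=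
  eval_iff e he.neg he.imp φ ψ

theorem iff_eq_one (he : IsValuation e) {φ ψ : Form A V} :
    (e (Form.iff φ ψ) : ℝ) = 1 ↔ (e φ : ℝ) = e ψ := by
  rw [he.iff, sub_eq_self, abs_eq_zero, sub_eq_zero]

theorem imp_eq_one (he : IsValuation e) {φ ψ : Form A V} :
    (e (.imp φ ψ) : ℝ) = 1 ↔ (e φ : ℝ) ≤ e ψ := by
  rw [he.imp, min_eq_right_iff]
  constructor <;> intro h <;> linarith

theorem pow (he : IsValuation e) (φ : Form A V) :
    ∀ k, (e (φ.pow k) : ℝ) = max (1 - k * (1 - (e φ : ℝ))) 0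
  | 0 => by simp [Form.pow, he.top]
  | 1 => by simpa [Form.pow] using (Luk.bounds (e φ)).1
  | k + 2 => by
    have h1 := Luk.bounds (e φ)
    have h2 : (0 : ℝ) ≤ ((k : ℝ) + 1) * (1 - e φ) :=
      mul_nonneg (by positivity) (by linarith)
    rw [Form.pow, he.odot, he.pow φ (k + 1)]
    push_cast
    have h3 : ((k : ℝ) + 2) * (1 - e φ) = (k + 1) * (1 - e φ) + (1 - e φ) := by ring
    rw [h3]
    generalize ((k : ℝ) + 1) * (1 - e φ) = t at *
    simp only [max_def]
    split_ifs <;> linarith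

end IsValuation

/-- The largest value below 1 is (n - 1)/n. This gap is what makes the n-th power of every smaller
value vanish. -/
theorem Luk.one_le_mul_of_ne_one {x : Luk n} (hx : (x : ℝ) ≠ 1) (hn : n ≠ 0) :
    1 ≤ (n : ℝ) * (1 - x) := by
  have hn0 : (n : ℝ) ≠ 0 := by exact_mod_cast hn
  obtain ⟨x, i, hi, rfl⟩ := x
  have hin : i ≠ n := by
    rintro rfl
    exact hx (div_self hn0)
  have h1 : (i : ℝ) + 1 ≤ n := by exact_mod_cast lt_of_le_of_ne hi hin
  rw [mul_sub, mul_div_cancel₀ _ hn0]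
  linarith

theorem IsValuation.pow_of_eq_one {e : Form A V → Luk n} (he : IsValuation e) {φ : Form A V}
    (h : (e φ : ℝ) = 1) (k : ℕ) : (e (φ.pow k) : ℝ) = 1 := by
  simp [he.pow, h]

theorem IsValuation.pow_of_ne_one {e : Form A V → Luk n} (he : IsValuation e) {φ : Form A V}
    (h : (e φ : ℝ) ≠ 1) (hn : n ≠ 0) : (e (φ.pow n) : ℝ) = 0 := by
  rw [he.pow]
  exact max_eq_right (by linarith [Luk.one_le_mul_of_ne_one h hn])

/-- Sets of formulas that contain the tautologies and are closed under modus ponens. -/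
structure IsTheory (n : ℕ) (T : Set (Form A V)) : Prop where
  mp : ∀ {φ ψ : Form A V}, φ ∈ T → .imp φ ψ ∈ T → ψ ∈ T
  taut : ∀ {φ : Form A V}, (∀ e : Form A V → Luk n, IsValuation e → (e φ : ℝ) = 1) → φ ∈ T

theorem isTheory_PDL : IsTheory n (PDL n A V) where
  mp h h' := (PDL.isLogic n A V).modus_ponens _ _ h h'
  taut h := (PDL.isLogic n A V).tautology _ fun e h0 hn hi => h e ⟨h0, hn, hi⟩

theorem imp_or_left (φ ψ : Form A V) : Form.imp φ (.or φ ψ) ∈ PDL n A V :=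
  isTheory_PDL.taut fun e he => by
    rw [he.imp_eq_one, he.or]
    exact le_max_left _ _

theorem imp_or_right (φ ψ : Form A V) : Form.imp ψ (.or φ ψ) ∈ PDL n A V :=
  isTheory_PDL.taut fun e he => by
    rw [he.imp_eq_one, he.or]
    exact le_max_right _ _

-- Deduction from a theory.

namespace IsTheory

variable {T : Set (Form A V)}

theorem odot_mem (hT : IsTheory n T) {φ ψ : Form A V} (hφ : φ ∈ T) (hψ : ψ ∈ T) :
    Form.odot φ ψ ∈ T := by
  refine hT.mp hψ (hT.mp hφ (hT.taut fun e he => ?_))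
  have h1 := Luk.bounds (e φ)
  have h2 := Luk.bounds (e ψ)
  simp only [he.imp, he.odot, min_def, max_def]
  split_ifs <;> linarith

/-- A deduction theorem: φ^n is 0 wherever φ is not 1, so the entailment turns φ^n → ψ into a
tautology, and T contains φ^n. -/
theorem mem_of_entails [NeZero n] (hT : IsTheory n T) {φ ψ : Form A V} (hφ : φ ∈ T)
    (h : ∀ e : Form A V → Luk n, IsValuation e → (e φ : ℝ) = 1 → (e ψ : ℝ) = 1) : ψ ∈ T := by
  have hpow : ∀ k, φ.pow k ∈ T := by
    intro k
    induction k with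
    | zero => exact hT.taut fun e he => he.top
    | succ k ih =>
      cases k with
      | zero => exact hφ
      | succ k => exact hT.odot_mem ih hφ
  refine hT.mp (hpow n) (hT.taut fun e he => ?_)
  rw [he.imp_eq_one]
  by_cases h1 : (e φ : ℝ) = 1
  · rw [h e he h1]
    exact (Luk.bounds _).2
  · rw [he.pow_of_ne_one h1 (NeZero.ne n)]
    exact (Luk.bounds _).1

end IsTheory

-- Compactness of the space of valuations.

instance Luk.instFinite : Finite (Luk n) := by
  have : Luk n ⊆ (fun i : ℕ => (i : ℝ) / (n : ℝ)) '' Set.Iic n := by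
    rintro x ⟨i, hi, rfl⟩
    exact ⟨i, hi, rfl⟩
  exact ((Set.finite_Iic n).image _).subset this

theorem continuous_eval (φ : Form A V) :
    Continuous fun e : Form A V → Luk n => (e φ : ℝ) :=
  continuous_subtype_val.comp (continuous_apply φ)

theorem isClosed_isValuation : IsClosed {e : Form A V → Luk n | IsValuation e} := by
  have : {e : Form A V → Luk n | IsValuation e} =
      {e | (e .bot : ℝ) = 0} ∩ ((⋂ φ, {e | (e (.neg φ) : ℝ) = 1 - (e φ : ℝ)}) ∩
        ⋂ φ, ⋂ ψ, {e | (e (.imp φ ψ) : ℝ) = min (1 - (e φ : ℝ) + (e ψ : ℝ)) 1}) := by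
    ext e
    simp only [Set.mem_inter_iff, Set.mem_iInter, Set.mem_ofPred_eq]
    exact ⟨fun h => ⟨h.bot, h.neg, h.imp⟩, fun h => ⟨h.1, h.2.1, h.2.2⟩⟩
  rw [this]
  refine (isClosed_eq (continuous_eval _) continuous_const).inter
    ((isClosed_iInter fun φ => isClosed_eq (continuous_eval _)
      (continuous_const.sub (continuous_eval _))).inter
    (isClosed_iInter fun φ => isClosed_iInter fun ψ => isClosed_eq (continuous_eval _)
      (((continuous_const.sub (continuous_eval _)).add (continuous_eval _)).min
        continuous_const)))

/-- Finiteness of `Luk n` matters here: the space is discrete, so the complement of the point 1 is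
closed. -/
theorem isClosed_ne_one (φ : Form A V) :
    IsClosed {e : Form A V → Luk n | (e φ : ℝ) ≠ 1} := by
  have h := (isClosed_discrete {x : Luk n | (x : ℝ) ≠ 1}).preimage
    (continuous_apply (A := fun _ : Form A V => Luk n) φ)
  exact h

/-- A theory can be separated by a valuation from a nonempty set of formulas that is directed for
the implication of the theory. -/
theorem IsTheory.exists_valuation [NeZero n] {T D : Set (Form A V)} (hT : IsTheory n T)
    (hD : D.Nonempty)
    (hdir : ∀ φ ∈ D, ∀ ψ ∈ D, ∃ χ ∈ D, Form.imp φ χ ∈ T ∧ Form.imp ψ χ ∈ T)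
    (hTD : ∀ φ ∈ D, φ ∉ T) :
    ∃ e : Form A V → Luk n, IsValuation e ∧ (∀ φ ∈ T, (e φ : ℝ) = 1) ∧
      ∀ φ ∈ D, (e φ : ℝ) ≠ 1 := by
  -- A common point of these closed sets is the required valuation; one formula of T and one of D
  -- per index makes the family directed.
  let C : T × D → Set (Form A V → Luk n) := fun p =>
    {e | IsValuation e} ∩ ({e | (e p.1 : ℝ) = 1} ∩ {e | (e p.2 : ℝ) ≠ 1})
  have hC : ∀ p, IsClosed (C p) := fun p => isClosed_isValuation.inter
    ((isClosed_eq (continuous_eval _) continuous_const).inter (isClosed_ne_one _))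
  have htop : Form.top ∈ T := hT.taut fun e he => he.top
  obtain ⟨d, hd⟩ := hD
  have : Nonempty (T × D) := ⟨(⟨_, htop⟩, ⟨d, hd⟩)⟩
  have hdirC : Directed (· ⊇ ·) C := by
    rintro ⟨⟨τ₁, h₁⟩, ⟨δ₁, hδ₁⟩⟩ ⟨⟨τ₂, h₂⟩, ⟨δ₂, hδ₂⟩⟩
    obtain ⟨χ, hχ, hi₁, hi₂⟩ := hdir δ₁ hδ₁ δ₂ hδ₂
    -- The implications into χ join the formula from T: once they are true, refuting χ refutes both
    -- δ₁ and δ₂.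
    refine ⟨(⟨_, hT.odot_mem (hT.odot_mem h₁ h₂) (hT.odot_mem hi₁ hi₂)⟩, ⟨χ, hχ⟩), ?_⟩
    have key : ∀ e : Form A V → Luk n, IsValuation e →
        (e (.odot (.odot τ₁ τ₂) (.odot (.imp δ₁ χ) (.imp δ₂ χ))) : ℝ) = 1 → (e χ : ℝ) ≠ 1 →
        ((e τ₁ : ℝ) = 1 ∧ (e δ₁ : ℝ) ≠ 1) ∧ ((e τ₂ : ℝ) = 1 ∧ (e δ₂ : ℝ) ≠ 1) := by
      intro e he h hne
      have hodot : ∀ φ ψ, (e (.odot φ ψ) : ℝ) = 1 → (e φ : ℝ) = 1 ∧ (e ψ : ℝ) = 1 := by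
        intro φ ψ h
        have h1 := Luk.bounds (e φ)
        have h2 := Luk.bounds (e ψ)
        rw [he.odot, max_def] at h
        split_ifs at h
        · norm_num at h
        · constructor <;> linarith
      obtain ⟨h1, h2⟩ := hodot _ _ h
      obtain ⟨h3, h4⟩ := hodot _ _ h1
      obtain ⟨h5, h6⟩ := hodot _ _ h2
      rw [he.imp_eq_one] at h5 h6
      have hlt := lt_of_le_of_ne (Luk.bounds (e χ)).2 hne
      exact ⟨⟨h3, (h5.trans_lt hlt).ne⟩, ⟨h4, (h6.trans_lt hlt).ne⟩⟩
    exact ⟨fun e he => ⟨he.1, (key e he.1 he.2.1 he.2.2).1⟩,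
      fun e he => ⟨he.1, (key e he.1 he.2.1 he.2.2).2⟩⟩
  have hne : ∀ p, (C p).Nonempty := by
    rintro ⟨⟨τ, hτ⟩, ⟨δ, hδ⟩⟩
    by_contra hemp
    -- If the set were empty, τ would entail δ, and δ would lie in T.
    refine hTD δ hδ (hT.mem_of_entails hτ fun e he h => ?_)
    by_contra h'
    exact hemp ⟨e, he, h, h'⟩
  obtain ⟨e, he⟩ := IsCompact.nonempty_iInter_of_directed_nonempty_isCompact_isClosed C hdirC hne
    (fun p => (hC p).isCompact) hC
  rw [Set.mem_iInter] at he
  exact ⟨e, (he (⟨_, htop⟩, ⟨d, hd⟩)).1, fun φ hφ => (he (⟨φ, hφ⟩, ⟨d, hd⟩)).2.1,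
    fun φ hφ => (he (⟨_, htop⟩, ⟨φ, hφ⟩)).2.2⟩

/- Threshold formulas. -/

/-- For `k < 2 ^ m`, the formula whose value is that of `2 ^ m φ - k`, truncated to `[0, 1]`. -/
def Form.threshold : ℕ → ℕ → Form A V → Form A V
  | 0, _, φ => φ
  | m + 1, k, φ =>
    if k < 2 ^ m then threshold m k (.oplus φ φ) else threshold m (k - 2 ^ m) (.odot φ φ)

/-- Truncating 2x at 1 loses nothing: when 2x ≥ 1, both sides are already saturated at 1 because N -
k ≥ 1. -/
theorem clamp_oplus {N k x : ℝ} (hN : 0 ≤ N) (hk : k + 1 ≤ N) :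
    max (min (N * min (x + x) 1 - k) 1) 0 = max (min (N * 2 * x - k) 1) 0 := by
  rcases le_total (x + x) 1 with h | h
  · rw [min_eq_left h]
    ring_nf
  · have h1 : N * 1 ≤ N * (x + x) := by gcongr
    rw [min_eq_right h, min_eq_right (by linarith), min_eq_right (by linarith)]

/-- Dually, when 2x - 1 ≤ 0 both sides are 0 because N ≤ k. -/
theorem clamp_odot {N k x : ℝ} (hN : 0 ≤ N) (hk : N ≤ k) :
    max (min (N * max (x + x - 1) 0 - (k - N)) 1) 0 = max (min (N * 2 * x - k) 1) 0 := by
  rcases le_total 0 (x + x - 1) with h | h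
  · rw [max_eq_left h]
    ring_nf
  · have h1 : N * (x + x - 1) ≤ N * 0 := by gcongr
    rw [max_eq_right h, min_eq_left (by linarith), min_eq_left (by linarith),
      max_eq_right (by linarith), max_eq_right (by linarith)]

/-- The leading binary digit of k selects the doubling: 2^(m+1) x - k equals both 2^m (2x) - k and
2^m (2x - 1) - (k - 2^m). -/
theorem IsValuation.threshold {e : Form A V → Luk n} (he : IsValuation e) :
    ∀ (m k : ℕ) (φ : Form A V), k < 2 ^ m →
      (e (Form.threshold m k φ) : ℝ) = max (min (2 ^ m * (e φ : ℝ) - k) 1) 0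
  | 0, k, φ, hk => by
    have h := Luk.bounds (e φ)
    obtain rfl : k = 0 := by simpa using hk
    simp [Form.threshold, h.1, h.2]
  | m + 1, k, φ, hk => by
    rw [Form.threshold]
    split_ifs with h
    · rw [he.threshold m k _ h, he.oplus, pow_succ]
      exact clamp_oplus (by positivity) (by exact_mod_cast h)
    · push Not at h
      rw [he.threshold m _ _ (by rw [pow_succ] at hk; omega), he.odot, pow_succ]
      push_cast [Nat.cast_sub h]
      exact clamp_odot (by positivity) (by exact_mod_cast h)

/-- By the axioms for [α](φ ⊕ φ) and [α](φ ⊙ φ), the value of [α]φ undergoes the same recursion as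
that of φ. -/
theorem IsValuation.box_threshold {e : Form A V → Luk n} (he : IsValuation e)
    (hPDL : ∀ φ ∈ PDL n A V, (e φ : ℝ) = 1) (α : Prog A V) :
    ∀ (m k : ℕ) (φ : Form A V), k < 2 ^ m →
      (e (.box α (Form.threshold m k φ)) : ℝ) = max (min (2 ^ m * (e (.box α φ) : ℝ) - k) 1) 0
  | 0, k, φ, hk => by
    have h := Luk.bounds (e (.box α φ))
    obtain rfl : k = 0 := by simpa using hk
    simp [Form.threshold, h.1, h.2]
  | m + 1, k, φ, hk => by
    rw [Form.threshold]
    split_ifs with h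
    · rw [he.box_threshold hPDL α m k _ h,
        he.iff_eq_one.1 (hPDL _ ((PDL.isLogic n A V).box_oplus α φ)), he.oplus, pow_succ]
      exact clamp_oplus (by positivity) (by exact_mod_cast h)
    · push Not at h
      rw [he.box_threshold hPDL α m _ _ (by rw [pow_succ] at hk; omega),
        he.iff_eq_one.1 (hPDL _ ((PDL.isLogic n A V).box_odot α φ)), he.odot, pow_succ]
      push_cast [Nat.cast_sub h]
      exact clamp_odot (by positivity) (by exact_mod_cast h)

theorem exists_dyadic_between {a b : ℝ} (ha : 0 ≤ a) (hab : a < b) (hb : b ≤ 1) :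
    ∃ m k : ℕ, k < 2 ^ m ∧ 2 ^ m * a ≤ (k : ℝ) ∧ (k : ℝ) + 1 ≤ 2 ^ m * b := by
  -- Once 2^m (b - a) > 2, the interval from 2^m a to 2^m b contains k and k + 1 for k = ⌈2^m a⌉.
  obtain ⟨m, hm⟩ := pow_unbounded_of_one_lt (2 / (b - a)) (one_lt_two (α := ℝ))
  rw [div_lt_iff₀ (by linarith)] at hm
  have h0 : (0 : ℝ) < 2 ^ m := by positivity
  have hk := Nat.ceil_lt_add_one (a := 2 ^ m * a) (by positivity)
  have hle : (⌈(2 : ℝ) ^ m * a⌉₊ : ℝ) + 1 ≤ 2 ^ m * b := by nlinarith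
  refine ⟨m, ⌈2 ^ m * a⌉₊, ?_, Nat.le_ceil _, hle⟩
  have h1 : (⌈(2 : ℝ) ^ m * a⌉₊ : ℝ) + 1 ≤ 2 ^ m := hle.trans (mul_le_of_le_one_right h0.le hb)
  exact_mod_cast h1

theorem exists_threshold {a b : ℝ} (ha : 0 ≤ a) (hab : a < b) (hb : b ≤ 1) :
    ∃ m k : ℕ, k < 2 ^ m ∧ (∀ x ≤ a, max (min (2 ^ m * x - k : ℝ) 1) 0 = 0) ∧
      ∀ x ≥ b, max (min (2 ^ m * x - k : ℝ) 1) 0 = 1 := by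
  obtain ⟨m, k, hk, h1, h2⟩ := exists_dyadic_between ha hab hb
  refine ⟨m, k, hk, fun x hx => max_eq_right (min_le_of_left_le ?_), fun x hx => ?_⟩
  · have : (2 : ℝ) ^ m * x ≤ 2 ^ m * a := by gcongr
    linarith
  · have : (2 : ℝ) ^ m * b ≤ 2 ^ m * x := by gcongr
    rw [min_eq_right (by linarith), max_eq_left zero_le_one]

/- Consistency of `PDL_n`: soundness for models with one world. -/

section OneWorld

variable [NeZero n]

open Classical in
mutual
/-- The value of a formula in a model with one world, that is a successor of itself for all atomic
programs. -/
noncomputable def Form.eval (p : V → Luk n) : Form A V → Luk n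
  | .var x => p x
  | .bot => MVAlgebra.neg MVAlgebra.one
  | .neg φ => MVAlgebra.neg (φ.eval p)
  | .imp φ ψ => MVAlgebra.imp (φ.eval p) (ψ.eval p)
  | .box α φ => if α.Loops p then φ.eval p else MVAlgebra.one
/-- The world of a model with one world is a successor of itself. -/
noncomputable def Prog.Loops (p : V → Luk n) : Prog A V → Prop
  | .atom _ => True
  | .test φ => (φ.eval p : ℝ) = 1
  | .seq α β => α.Loops p ∧ β.Loops p
  | .union α β => α.Loops p ∨ β.Loops p
  | .star _ => True
end

theorem Form.isValuation_eval (p : V → Luk n) :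
    IsValuation (Form.eval p : Form A V → Luk n) where
  bot := by
    rw [Form.eval]
    exact sub_self 1
  neg φ := by
    rw [Form.eval]
    rfl
  imp φ ψ := by
    rw [Form.eval]
    rfl

mutual
theorem Form.eval_subst (p : V → Luk n) (σ : V → Form A V) :
    ∀ φ : Form A V, (φ.subst σ).eval p = φ.eval fun x => (σ x).eval p
  | .var x => by simp only [Form.subst, Form.eval]
  | .bot => by simp only [Form.subst, Form.eval]
  | .neg φ => by simp only [Form.subst, Form.eval, Form.eval_subst p σ φ]
  | .imp φ ψ => by
    simp only [Form.subst, Form.eval, Form.eval_subst p σ φ, Form.eval_subst p σ ψ]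
  | .box α φ => by
    rw [Form.subst, Form.eval, Form.eval, Form.eval_subst p σ φ]
    classical exact if_congr (Prog.loops_subst p σ α) rfl rfl
theorem Prog.loops_subst (p : V → Luk n) (σ : V → Form A V) :
    ∀ α : Prog A V, (α.subst σ).Loops p ↔ α.Loops fun x => (σ x).eval p
  | .atom _ => by simp only [Prog.subst, Prog.Loops]
  | .test φ => by simp only [Prog.subst, Prog.Loops, Form.eval_subst p σ φ]
  | .seq α β => by
    simp only [Prog.subst, Prog.Loops, Prog.loops_subst p σ α, Prog.loops_subst p σ β]
  | .union α β => by
    simp only [Prog.subst, Prog.Loops, Prog.loops_subst p σ α, Prog.loops_subst p σ β]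
  | .star _ => by simp only [Prog.subst, Prog.Loops]
end

open Classical in
theorem Form.eval_box (p : V → Luk n) (α : Prog A V) (φ : Form A V) :
    ((Form.box α φ).eval p : ℝ) = if α.Loops p then (φ.eval p : ℝ) else 1 := by
  rw [Form.eval]
  split_ifs <;> rfl

theorem Form.eval_box_star (p : V → Luk n) (α : Prog A V) (φ : Form A V) :
    ((Form.box (.star α) φ).eval p : ℝ) = φ.eval p := by
  rw [Form.eval_box, if_pos (by rw [Prog.Loops]; trivial)]

/-- Here [α]φ has the value of φ or 1, and [α*]φ always that of φ. Quantifying over all p gives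
closure under substitution, which merely changes the assignment. -/
theorem isLogic_oneWorld :
    IsLogic n {φ : Form A V | ∀ p : V → Luk n, (φ.eval p : ℝ) = 1} where
  modus_ponens φ ψ h h' p := by
    have := (Form.isValuation_eval p).imp_eq_one.1 (h' p)
    rw [h p] at this
    exact le_antisymm (Luk.bounds _).2 this
  substitution σ φ h p := by
    rw [Form.eval_subst]
    exact h _
  necessitation α φ h p := by
    rw [Form.eval_box, h p, ite_self]
  tautology φ h p :=
    have he := Form.isValuation_eval p
    h _ he.bot he.neg he.imp
  box_imp α φ ψ p := by
    have he := Form.isValuation_eval (A := A) p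
    rw [he.imp_eq_one, he.imp]
    simp only [Form.eval_box]
    split_ifs
    · rw [he.imp]
    · norm_num
  box_oplus α φ p := by
    have he := Form.isValuation_eval (A := A) p
    rw [he.iff_eq_one, he.oplus]
    simp only [Form.eval_box]
    split_ifs
    · rw [he.oplus]
    · norm_num
  box_odot α φ p := by
    have he := Form.isValuation_eval (A := A) p
    rw [he.iff_eq_one, he.odot]
    simp only [Form.eval_box]
    split_ifs
    · rw [he.odot]
    · norm_num
  box_union α β φ p := by
    have he := Form.isValuation_eval (A := A) p
    have h := Luk.bounds (φ.eval p)
    rw [he.iff_eq_one, he.and]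
    simp only [Form.eval_box, Prog.Loops]
    by_cases h1 : α.Loops p <;> by_cases h2 : β.Loops p <;> simp [h1, h2, h.2]
  box_seq α β φ p := by
    have he := Form.isValuation_eval (A := A) p
    rw [he.iff_eq_one]
    simp only [Form.eval_box, Prog.Loops]
    by_cases h1 : α.Loops p <;> by_cases h2 : β.Loops p <;> simp [h1, h2]
  box_test ψ φ p := by
    have he := Form.isValuation_eval (A := A) p
    have h := Luk.bounds (φ.eval p)
    rw [he.iff_eq_one, he.or, he.neg, Form.eval_box]
    by_cases h1 : (ψ.eval p : ℝ) = 1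
    · rw [he.pow_of_eq_one h1, if_pos (by rwa [Prog.Loops]), sub_self, max_eq_right h.1]
    · rw [he.pow_of_ne_one h1 (NeZero.ne n), if_neg (by rwa [Prog.Loops]), sub_zero,
        max_eq_left h.2]
  box_star α φ p := by
    have he := Form.isValuation_eval (A := A) p
    have h := Luk.bounds (φ.eval p)
    rw [he.iff_eq_one, he.and, Form.eval_box p α]
    simp only [Form.eval_box_star]
    split_ifs <;> simp [h.2]
  box_star_star α φ p := by
    have he := Form.isValuation_eval (A := A) p
    rw [he.imp_eq_one]
    simp only [Form.eval_box_star, le_refl]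
  induction α φ p := by
    have he := Form.isValuation_eval (A := A) p
    rw [he.imp_eq_one, he.and]
    simp only [Form.eval_box_star]
    exact min_le_left _ _

end OneWorld

/- Worlds of the canonical model as valuations. -/

section Worlds

variable [NeZero n]

/-- The homomorphism induced by a valuation that satisfies `PDL_n`. -/
def IsValuation.toMVHom {e : Form A V → Luk n} (he : IsValuation e)
    (hPDL : ∀ φ ∈ PDL n A V, (e φ : ℝ) = 1) : MVHom (LTAlgebra n A V) (Luk n) where
  toFun := Quotient.lift e fun _ _ h => Subtype.ext (he.iff_eq_one.1 (hPDL _ h))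
  map_imp x y := by
    induction x using Quotient.inductionOn with | h φ => ?_
    induction y using Quotient.inductionOn with | h ψ => ?_
    exact Subtype.ext (he.imp φ ψ)
  map_neg x := by
    induction x using Quotient.inductionOn with | h φ => ?_
    exact Subtype.ext (he.neg φ)
  map_one := Subtype.ext he.top

namespace MVHom

/-- The value of a formula under a homomorphism. -/
def val (f : MVHom (LTAlgebra n A V) (Luk n)) (φ : Form A V) : Luk n :=
  f.toFun (LTAlgebra.mk n φ)

variable (f g : MVHom (LTAlgebra n A V) (Luk n))

theorem isValuation : IsValuation f.val where
  bot := by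
    -- The unit of `LTAlgebra` is by definition the class of ¬0.
    have h : 1 - (f.val .bot : ℝ) = 1 :=
      (congrArg Subtype.val (f.map_neg (LTAlgebra.mk n .bot))).symm.trans
        (congrArg Subtype.val f.map_one)
    linarith
  neg φ := congrArg Subtype.val (f.map_neg (LTAlgebra.mk n φ))
  imp φ ψ := congrArg Subtype.val (f.map_imp (LTAlgebra.mk n φ) (LTAlgebra.mk n ψ))

theorem val_eq_one {φ : Form A V} (h : φ ∈ PDL n A V) : (f.val φ : ℝ) = 1 := by
  have h1 : Form.iff φ .top ∈ PDL n A V := by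
    refine isTheory_PDL.mem_of_entails h fun e he h => ?_
    rw [he.iff_eq_one, h, he.top]
  have h2 : LTAlgebra.mk n φ = LTAlgebra.mk n .top := Quotient.sound h1
  rw [val, h2]
  exact f.isValuation.top

theorem val_eq {φ ψ : Form A V} (h : Form.iff φ ψ ∈ PDL n A V) : (f.val φ : ℝ) = f.val ψ :=
  f.isValuation.iff_eq_one.1 (f.val_eq_one h)

theorem val_le {φ ψ : Form A V} (h : Form.imp φ ψ ∈ PDL n A V) : (f.val φ : ℝ) ≤ f.val ψ :=
  f.isValuation.imp_eq_one.1 (f.val_eq_one h)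

theorem val_box_mono (α : Prog A V) {φ ψ : Form A V} (h : Form.imp φ ψ ∈ PDL n A V) :
    (f.val (.box α φ) : ℝ) ≤ f.val (.box α ψ) :=
  f.val_le ((PDL.isLogic n A V).modus_ponens _ _ ((PDL.isLogic n A V).necessitation α _ h)
    ((PDL.isLogic n A V).box_imp α φ ψ))

/-- The formulas that are necessary at a world for a program form a theory. -/
theorem isTheory_box (α : Prog A V) : IsTheory n {φ | (f.val (.box α φ) : ℝ) = 1} where
  mp {φ ψ} h h' := by
    have h1 := f.val_le ((PDL.isLogic n A V).box_imp α φ ψ)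
    rw [h', f.isValuation.imp] at h1
    have h2 : (f.val (.box α φ) : ℝ) = 1 := h
    rw [h2] at h1
    refine le_antisymm (Luk.bounds _).2 ?_
    simpa using h1
  taut h := f.val_eq_one
    ((PDL.isLogic n A V).necessitation α _ (isTheory_PDL.taut h))

variable {f g}

/-- If f exceeded g at φ, a threshold formula would be 1 at f and 0 at g. So f ≤ g everywhere, and
negation reverses the inequality. -/
theorem ext_of_val_le (h : ∀ φ, (f.val φ : ℝ) = 1 → (g.val φ : ℝ) = 1) : f = g := by
  have hle : ∀ φ, (f.val φ : ℝ) ≤ g.val φ := by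
    intro φ
    by_contra hlt
    push Not at hlt
    obtain ⟨m, k, hk, h0, h1⟩ :=
      exists_threshold (Luk.bounds (g.val φ)).1 hlt (Luk.bounds (f.val φ)).2
    have := h (Form.threshold m k φ)
      (by rw [f.isValuation.threshold m k φ hk, h1 _ le_rfl])
    rw [g.isValuation.threshold m k φ hk, h0 _ le_rfl] at this
    exact zero_ne_one this
  have heq : f.toFun = g.toFun := by
    funext x
    induction x using Quotient.inductionOn with | h φ => ?_
    refine Subtype.ext (le_antisymm (hle φ) ?_)
    have h1 := hle (.neg φ)
    rw [f.isValuation.neg, g.isValuation.neg] at h1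
    have h2 : (g.val φ : ℝ) ≤ f.val φ := by linarith
    exact h2
  cases f
  cases g
  cases heq
  rfl

end MVHom

-- Existence of successors and the truth lemma for [α].

theorem canonicalModel_rel_iff {α : Prog A V} {f g : MVHom (LTAlgebra n A V) (Luk n)} :
    (canonicalModel n A V).R α f g ↔
      ∀ φ, (f.val (.box α φ) : ℝ) = 1 → (g.val φ : ℝ) = 1 := by
  refine ⟨fun h φ => h (LTAlgebra.mk n φ), fun h x => ?_⟩
  induction x using Quotient.inductionOn with | h φ => exact h φ

/-- Existence of successors that refute all formulas of a directed set. -/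
theorem exists_rel (f : MVHom (LTAlgebra n A V) (Luk n)) (α : Prog A V) {D : Set (Form A V)}
    (hD : D.Nonempty)
    (hdir : ∀ φ ∈ D, ∀ ψ ∈ D, ∃ χ ∈ D, Form.imp φ χ ∈ PDL n A V ∧ Form.imp ψ χ ∈ PDL n A V)
    (hf : ∀ φ ∈ D, (f.val (.box α φ) : ℝ) ≠ 1) :
    ∃ g : MVHom (LTAlgebra n A V) (Luk n), (canonicalModel n A V).R α f g ∧
      ∀ φ ∈ D, (g.val φ : ℝ) ≠ 1 := by
  have hsub : ∀ φ ∈ PDL n A V, (f.val (.box α φ) : ℝ) = 1 := fun φ h =>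
    f.val_eq_one ((PDL.isLogic n A V).necessitation α φ h)
  obtain ⟨e, he, h1, h2⟩ := (f.isTheory_box α).exists_valuation hD
    (fun φ hφ ψ hψ =>
      let ⟨χ, hχ, h, h'⟩ := hdir φ hφ ψ hψ
      ⟨χ, hχ, hsub _ h, hsub _ h'⟩) hf
  exact ⟨he.toMVHom fun φ h => h1 φ (hsub φ h), canonicalModel_rel_iff.2 h1, h2⟩

theorem exists_rel_of_ne_one (f : MVHom (LTAlgebra n A V) (Luk n)) (α : Prog A V) {φ : Form A V}
    (hf : (f.val (.box α φ) : ℝ) ≠ 1) :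
    ∃ g : MVHom (LTAlgebra n A V) (Luk n), (canonicalModel n A V).R α f g ∧
      (g.val φ : ℝ) ≠ 1 := by
  have hid : Form.imp φ φ ∈ PDL n A V := isTheory_PDL.taut fun e he => he.imp_eq_one.2 le_rfl
  obtain ⟨g, hg, h⟩ := exists_rel f α (D := {φ}) ⟨φ, rfl⟩
    (by rintro _ rfl _ rfl; exact ⟨_, rfl, hid, hid⟩) (by rintro _ rfl; exact hf)
  exact ⟨g, hg, h φ rfl⟩

/-- Both halves separate two values by a threshold formula and move it through [α]. A world without
successors needs no separate case: there every c is a lower bound, and the second half applies. -/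
theorem canonicalModel_isGLB (f : MVHom (LTAlgebra n A V) (Luk n)) (α : Prog A V)
    (φ : Form A V) :
    IsGLB {t : Luk n | ∃ g, (canonicalModel n A V).R α f g ∧ (canonicalModel n A V).Val g φ = t}
      (f.val (.box α φ)) := by
  constructor
  · rintro _ ⟨g, hg, rfl⟩
    change (f.val (.box α φ) : ℝ) ≤ MVHom.val g φ
    by_contra hlt
    push Not at hlt
    obtain ⟨m, k, hk, h0, h1⟩ := exists_threshold (Luk.bounds _).1 hlt (Luk.bounds _).2
    have := canonicalModel_rel_iff.1 hg (Form.threshold m k φ)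
      (by rw [f.isValuation.box_threshold (fun _ => f.val_eq_one) α m k φ hk, h1 _ le_rfl])
    rw [(MVHom.isValuation g).threshold m k φ hk, h0 _ le_rfl] at this
    exact zero_ne_one this
  · intro c hc
    change (c : ℝ) ≤ f.val (.box α φ)
    by_contra hlt
    push Not at hlt
    obtain ⟨m, k, hk, h0, h1⟩ := exists_threshold (Luk.bounds _).1 hlt (Luk.bounds _).2
    obtain ⟨g, hg, hne⟩ := exists_rel_of_ne_one f α (φ := Form.threshold m k φ)
      (by
        rw [f.isValuation.box_threshold (fun _ => f.val_eq_one) α m k φ hk, h0 _ le_rfl]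
        exact zero_ne_one)
    have hcg : (c : ℝ) ≤ g.val φ := hc ⟨g, hg, rfl⟩
    exact hne (by rw [g.isValuation.threshold m k φ hk, h1 _ hcg])

-- Relations of compound programs.

theorem MVHom.val_or_ne_one {f : MVHom (LTAlgebra n A V) (Luk n)} {φ ψ : Form A V}
    (hφ : (f.val φ : ℝ) ≠ 1) (hψ : (f.val ψ : ℝ) ≠ 1) : (f.val (.or φ ψ) : ℝ) ≠ 1 := by
  rw [f.isValuation.or]
  exact (max_lt (lt_of_le_of_ne (Luk.bounds _).2 hφ) (lt_of_le_of_ne (Luk.bounds _).2 hψ)).ne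

/-- The intermediate world has to be an α-successor of f that refutes [β]φ whenever h does not give
φ the value 1. These formulas are directed through φ ∨ ψ, since [β] is monotone. -/
theorem canonicalModel_rel_seq {α β : Prog A V} {f h : MVHom (LTAlgebra n A V) (Luk n)} :
    (canonicalModel n A V).R (.seq α β) f h ↔
      ∃ g, (canonicalModel n A V).R α f g ∧ (canonicalModel n A V).R β g h := by
  constructor
  · intro hR
    rw [canonicalModel_rel_iff] at hR
    obtain ⟨g, hg, hne⟩ := exists_rel f α (D := Form.box β '' {φ | (h.val φ : ℝ) ≠ 1})
      ⟨_, .bot, by simp [h.isValuation.bot], rfl⟩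
      (by
        rintro _ ⟨φ, hφ, rfl⟩ _ ⟨ψ, hψ, rfl⟩
        refine ⟨_, ⟨.or φ ψ, MVHom.val_or_ne_one hφ hψ, rfl⟩, ?_, ?_⟩
        · exact (PDL.isLogic n A V).modus_ponens _ _
            ((PDL.isLogic n A V).necessitation β _ (imp_or_left φ ψ))
            ((PDL.isLogic n A V).box_imp β _ _)
        · exact (PDL.isLogic n A V).modus_ponens _ _
            ((PDL.isLogic n A V).necessitation β _ (imp_or_right φ ψ))
            ((PDL.isLogic n A V).box_imp β _ _))
      (by
        rintro _ ⟨φ, hφ, rfl⟩ h1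
        rw [← f.val_eq ((PDL.isLogic n A V).box_seq α β φ)] at h1
        exact hφ (hR φ h1))
    refine ⟨g, hg, canonicalModel_rel_iff.2 fun φ h1 => ?_⟩
    by_contra h2
    exact hne _ ⟨φ, h2, rfl⟩ h1
  · rintro ⟨g, hfg, hgh⟩
    refine canonicalModel_rel_iff.2 fun φ h1 => ?_
    rw [f.val_eq ((PDL.isLogic n A V).box_seq α β φ)] at h1
    exact canonicalModel_rel_iff.1 hgh _ (canonicalModel_rel_iff.1 hfg _ h1)

theorem MVHom.val_box_union {f : MVHom (LTAlgebra n A V) (Luk n)} {α β : Prog A V}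
    {φ : Form A V} : (f.val (.box (.union α β) φ) : ℝ) = 1 ↔
      (f.val (.box α φ) : ℝ) = 1 ∧ (f.val (.box β φ) : ℝ) = 1 := by
  have h1 := Luk.bounds (f.val (.box α φ))
  have h2 := Luk.bounds (f.val (.box β φ))
  rw [f.val_eq ((PDL.isLogic n A V).box_union α β φ), f.isValuation.and]
  constructor
  · intro h
    have h3 := min_le_left (f.val (.box α φ) : ℝ) (f.val (.box β φ))
    have h4 := min_le_right (f.val (.box α φ) : ℝ) (f.val (.box β φ))
    constructor <;> linarith
  · rintro ⟨h3, h4⟩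
    rw [h3, h4, min_self]

theorem canonicalModel_rel_union {α β : Prog A V} {f g : MVHom (LTAlgebra n A V) (Luk n)} :
    (canonicalModel n A V).R (.union α β) f g ↔
      (canonicalModel n A V).R α f g ∨ (canonicalModel n A V).R β f g := by
  simp only [canonicalModel_rel_iff, MVHom.val_box_union]
  constructor
  · intro h
    by_contra! hne
    obtain ⟨⟨φ, hφ, hφg⟩, ⟨ψ, hψ, hψg⟩⟩ := hne
    -- If φ and ψ witness the failure of the two relations, φ ∨ ψ is necessary at f for both
    -- programs, yet not true at g.
    refine MVHom.val_or_ne_one hφg hψg (h _ ⟨?_, ?_⟩)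
    · exact le_antisymm (Luk.bounds _).2 (hφ.symm.le.trans (f.val_box_mono α (imp_or_left φ ψ)))
    · exact le_antisymm (Luk.bounds _).2 (hψ.symm.le.trans (f.val_box_mono β (imp_or_right φ ψ)))
  · rintro (h | h) φ hφ
    exacts [h φ hφ.1, h φ hφ.2]

theorem canonicalModel_rel_test {ψ : Form A V} {f g : MVHom (LTAlgebra n A V) (Luk n)} :
    (canonicalModel n A V).R (.test ψ) f g ↔ f = g ∧ (f.val ψ : ℝ) = 1 := by
  rw [canonicalModel_rel_iff]
  have hbox : ∀ φ, (f.val (.box (.test ψ) φ) : ℝ) = max (1 - (f.val (ψ.pow n) : ℝ)) (f.val φ) := by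
    intro φ
    rw [f.val_eq ((PDL.isLogic n A V).box_test ψ φ), f.isValuation.or, f.isValuation.neg]
  simp only [hbox]
  by_cases hψ : (f.val ψ : ℝ) = 1
  · simp only [f.isValuation.pow_of_eq_one hψ, sub_self, max_eq_right (Luk.bounds _).1]
    refine ⟨fun h => ⟨MVHom.ext_of_val_le h, hψ⟩, ?_⟩
    rintro ⟨rfl, -⟩ φ h
    exact h
  · simp only [f.isValuation.pow_of_ne_one hψ (NeZero.ne n), sub_zero,
      max_eq_left (Luk.bounds _).2, hψ, and_false, iff_false, forall_const]
    -- Now [ψ?]φ has the value 1 at f for every φ; with φ = 0 this excludes every successor.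
    intro h
    have := h .bot
    rw [g.isValuation.bot] at this
    exact zero_ne_one this

theorem MVHom.val_box_star {f : MVHom (LTAlgebra n A V) (Luk n)} {α : Prog A V} {φ : Form A V}
    (h : (f.val (.box (.star α) φ) : ℝ) = 1) :
    (f.val φ : ℝ) = 1 ∧ (f.val (.box α (.box (.star α) φ)) : ℝ) = 1 := by
  rw [f.val_eq ((PDL.isLogic n A V).box_star α φ), f.isValuation.and] at h
  exact ⟨le_antisymm (Luk.bounds _).2 (h.symm.le.trans (min_le_left _ _)),
    le_antisymm (Luk.bounds _).2 (h.symm.le.trans (min_le_right _ _))⟩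

theorem canonicalModel_isNonStandard : (canonicalModel n A V).IsNonStandard where
  nonempty := ⟨(Form.isValuation_eval fun _ => MVAlgebra.one).toMVHom
    fun _ h => h _ isLogic_oneWorld _⟩
  val_bot f := (MVHom.isValuation f).bot
  val_imp f := (MVHom.isValuation f).imp
  val_neg f := (MVHom.isValuation f).neg
  val_box f := canonicalModel_isGLB f
  rel_seq _ _ _ _ := canonicalModel_rel_seq
  rel_union _ _ _ _ := canonicalModel_rel_union
  rel_test _ _ _ := canonicalModel_rel_test
  star_refl _ _ := canonicalModel_rel_iff.2 fun _ h => (MVHom.val_box_star h).1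
  star_trans α f _ _ hfg hgh := canonicalModel_rel_iff.2 fun φ h1 =>
    canonicalModel_rel_iff.1 hgh _ (canonicalModel_rel_iff.1 hfg _
      (le_antisymm (Luk.bounds _).2
        (h1.symm.le.trans (MVHom.val_le f ((PDL.isLogic n A V).box_star_star α φ)))))
  -- The value 1 passes from [α*]φ to [α][α*]φ at the first world, then to [α*]φ and to φ at its
  -- successor.
  star_extends _ _ _ h := canonicalModel_rel_iff.2 fun _ h1 =>
    (MVHom.val_box_star (canonicalModel_rel_iff.1 h _ (MVHom.val_box_star h1).2)).1
  models_star α φ f :=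
    MVHom.val_eq_one f (PDL.imp_of_iff ((PDL.isLogic n A V).box_star α φ))
  models_star_star α φ f := MVHom.val_eq_one f ((PDL.isLogic n A V).box_star_star α φ)
  models_induction α φ f := MVHom.val_eq_one f ((PDL.isLogic n A V).induction α φ)

end Worlds

end Canonical

end PDLn

theorem mainTheorem3 (A : Type u) (V : Type v) (n : ℕ) [NeZero n] :
    (PDLn.canonicalModel n A V).IsNonStandard ∧
      ∀ (α : PDLn.Prog A V) (φ : PDLn.Form A V),
        (PDLn.canonicalModel n A V).Models
          (PDLn.Form.iff (.box (.star α) φ) (.and φ (.box α (.box (.star α) φ)))) :=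
  ⟨PDLn.canonicalModel_isNonStandard, fun α φ f =>
    PDLn.MVHom.val_eq_one f ((PDLn.PDL.isLogic n A V).box_star α φ)⟩
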